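/- Let $\Gamma=H(11,2)$ be the Hamming graph with vertex set $\{0,1\}^{\mathbb F_{11}}$, two vertices being adjacent when they differ in exactly one entry; let $\mathrm{Aut}(\Gamma)$ be its automorphism group and $N\cong S_2^{11}$ the subgroup of automorphisms that act by a permutation of $\{0,1\}$ in each entry, that is, the kernel of the action of $\mathrm{Aut}(\Gamma)$ on the set of entries. For a code $C\subseteq V(\Gamma)$ let $\mathrm{Aut}(C)$ be its setwise stabiliser in $\mathrm{Aut}(\Gamma)$, let $C_r$ be the set of vertices whose Hamming distance to $C$ is exactly $r$ (so $C_0=C$), and let $\rho$ be the covering radius of $C$, the largest $r$ with $C_r\neq\emptyset$. For a subgroup $X\le\mathrm{Aut}(C)$, the code $C$ is $(X,s)$-neighbour transitive if each of $C,C_1,\dots,C_s$ is an $X$-orbit; it is $X$-completely transitive if it is $(X,\rho)$-neighbour transitive. It is entry-faithful $(X,s)$-neighbour transitive if moreover $X$ acts faithfully on entries, that is, $X\cap N=1$. Let $H_{12}$ be the $12\times 12$ matrix with columns labelled by $\mathbb F_{11}\cup\{*\}$ whose rows are the $11$ translates under the additive group of $\mathbb F_{11}$ (which fixes $*$) of the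 vector $v$ with $v_a=-1$ if $a$ is a square in $\mathbb F_{11}$ (including $0$) and $v_a=1$ if $a$ is a non-square or $a=*$, together with the constant row $(-1,\dots,-1)$. The Hadamard code of length $12$ consists of the rows of $H_{12}$ and $-H_{12}$, with $1$ replaced by $0$ and $-1$ replaced by $1$; the punctured Hadamard 12 code $\mathcal P\subseteq V(\Gamma)$ is obtained from it by deleting the coordinate $*$; and $\mathcal E$ is the subcode of $\mathcal P$ consisting of the codewords of even weight. Then: 1. for every subgroup $X\le\mathrm{Aut}(\Gamma)$, the code $\mathcal E$ is entry-faithful $(X,2)$-neighbour transitive if and only if $X=\mathrm{Aut}(\mathcal E)$; 2. $\mathrm{Aut}(\mathcal E)$ is isomorphic to the Mathieu group $M_{11}$; 3. $\mathrm{Aut}(\mathcal E)$ acts faithfully on entries; 4. $\mathcal E$ is not $(X,3)$-neighbour transitive for any group $X$; in particular, $\mathcal E$ is not $X$-completely transitive for any group $X$. -/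

import Mathlib

open scoped Pointwise

/-- The Hamming graph `H(m, q)`, with set of entries `M` and alphabet `Q`: the vertices are the
tuples `M → Q`, and two vertices are adjacent when they differ in exactly one entry. -/
def hammingGraph (M Q : Type*) [Fintype M] [DecidableEq Q] : SimpleGraph (M → Q) where
  Adj α β := hammingDist α β = 1
  symm := ⟨fun α β h => by rw [hammingDist_comm]; exact h⟩
  loopless := ⟨fun α h => by simp at h⟩

/-- The full automorphism group of the Hamming graph, acting on the vertices. -/
abbrev HammingAut (M Q : Type*) [Fintype M] [DecidableEq Q] : Type _ :=
  hammingGraph M Q ≃g hammingGraph M Q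

/-- The base group `N ≅ S_q ^ m` of the automorphism group of the Hamming graph: the
automorphisms `(h_i)` applying a permutation `h_i` of the alphabet in each entry `i`.
It is the kernel of the action of the automorphism group on the set of entries. -/
def baseGroup (M Q : Type*) [Fintype M] [DecidableEq Q] : Subgroup (HammingAut M Q) where
  carrier := {x | ∃ h : M → Equiv.Perm Q, ∀ α i, x α i = h i (α i)}
  one_mem' := ⟨fun _ => 1, fun _ _ => rfl⟩
  mul_mem' := by
    rintro x y ⟨g, hg⟩ ⟨h, hh⟩
    exact ⟨fun i => g i * h i, fun α i => by
      rw [RelIso.mul_apply, hg, hh, Equiv.Perm.mul_apply]⟩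
  inv_mem' := by
    rintro x ⟨g, hg⟩
    refine ⟨fun i => (g i)⁻¹, fun α i => ?_⟩
    rw [Equiv.Perm.eq_inv_iff_eq, ← hg, RelIso.apply_inv_self]

section Codes

variable {M Q : Type*} [Fintype M] [DecidableEq Q]

/-- The automorphism group of a code: its setwise stabiliser in the automorphism group of the
Hamming graph. -/
def codeAut (C : Set (M → Q)) : Subgroup (HammingAut M Q) :=
  MulAction.stabilizer (HammingAut M Q) C

/-- The set `C_r` of vertices whose distance to the code `C` is exactly `r`; `C_0 = C`. -/
def neighbourSet (C : Set (M → Q)) (r : ℕ) : Set (M → Q) :=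
  {α | IsLeast {d | ∃ β ∈ C, hammingDist α β = d} r}

/-- The covering radius: the largest distance of a vertex to the code. -/
noncomputable def coveringRadius (C : Set (M → Q)) : ℕ :=
  sSup {r | (neighbourSet C r).Nonempty}

/-- `C` is `(X, s)`-neighbour transitive: `X` is a group of automorphisms of `C`, and each of
`C = C_0, C_1, …, C_s` is an orbit of `X` on the vertices. -/
def IsNeighbourTransitive (X : Subgroup (HammingAut M Q)) (s : ℕ) (C : Set (M → Q)) : Prop :=
  X ≤ codeAut C ∧ ∀ i ≤ s, ∃ α, neighbourSet C i = MulAction.orbit X α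

/-- `C` is `X`-completely transitive. -/
def IsCompletelyTransitive (X : Subgroup (HammingAut M Q)) (C : Set (M → Q)) : Prop :=
  IsNeighbourTransitive X (coveringRadius C) C

/-- `X` acts faithfully on the set of entries. -/
def IsEntryFaithful (X : Subgroup (HammingAut M Q)) : Prop :=
  X ⊓ baseGroup M Q = ⊥

end Codes

/-- The normalised Hadamard matrix of order 12 from the Paley construction, with entries
labelled by `𝔽₁₁ ∪ {*}`, where `*` is `none`. Row `some b` is the translate by `b` of the vector
that is `-1` at the squares of `𝔽₁₁` (including `0`) and `1` at the non-squares and at `*`;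
row `none` is the constant vector `-1`. -/
def paleyHadamard : Matrix (Option (ZMod 11)) (Option (ZMod 11)) ℤ
  | some b, some a => if IsSquare (a - b) then -1 else 1
  | some _, none => 1
  | none, _ => -1

/-- The Hadamard code of length 12: the rows `u` of `H₁₂` and of `-H₁₂`, with `1` replaced by `0`
and `-1` replaced by `1`. -/
def hadamardCode : Set (Option (ZMod 11) → ZMod 2) :=
  {α | ∃ u : Option (ZMod 11) → ℤ, (∃ r, u = paleyHadamard r ∨ u = -paleyHadamard r) ∧
    ∀ a, α a = if u a = 1 then 0 else 1}

/-- The punctured Hadamard 12 code: the coordinate `*` is deleted. -/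
def puncturedHadamardCode : Set (ZMod 11 → ZMod 2) :=
  (fun α a => α (some a)) '' hadamardCode

/-- The even weight subcode of the punctured Hadamard 12 code. -/
def evenHadamardCode : Set (ZMod 11 → ZMod 2) :=
  {α ∈ puncturedHadamardCode | Even (hammingNorm α)}

/-- The Mathieu group `M₁₁`, by its standard generators on 11 points (here numbered from 0)
`(1,2,3,4,5,6,7,8,9,10,11)` and `(3,7,11,8)(4,10,5,6)`. -/
def mathieuM11 : Subgroup (Equiv.Perm (Fin 11)) :=
  Subgroup.closure {finRotate 11,
    List.formPerm [2, 6, 10, 7] * List.formPerm [3, 9, 4, 5]}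

/-! ### Automorphisms of Hamming graphs -/

section HammingAut

variable {M Q : Type*} [Fintype M] [DecidableEq Q]

/-! Every automorphism of a binary Hamming graph permutes the entries and then adds a vector. The
code has 12 codewords at pairwise distance 6, namely zero and the blocks of a 2-(11,6,3) design. No
nonzero translation by a codeword preserves it, so its group acts faithfully on entries.

A translation of `ZMod 11` and a signed form of the second generator of M₁₁ preserve the code. They
generate its whole group by a stabiliser chain: the group they generate is transitive on codewords,
the stabiliser of zero is transitive on ordered pairs of entries, and fixing 0 and 1 leaves six
possible images of 2, all attained; nothing more remains (`eq_one_of_fixes`). So the image on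
entries is M₁₁ by its generators. Transitivity on pairs gives 2-neighbour transitivity. It fails at
distance 3 because triples of entries lie in different numbers of blocks.

Conversely, let X be 2-neighbour transitive. Then |C₂| = 660 divides |X|, and elements of order 3
fix a codeword (`exists_fixed_codeword`), so 36 divides |X| as well. Thus 1980 divides |X| and X has
index less than 11. Such a subgroup contains all elements of order 11, and these generate the group.
-/

instance [Finite Q] : Finite (HammingAut M Q) :=
  Finite.of_injective (fun x : HammingAut M Q => (x : (M → Q) → M → Q)) DFunLike.coe_injective

/-- Changing one entry at a time gives a path of length `n` from `α` to `β`, and its image is again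
a path. -/
theorem hammingDist_map_le (x : HammingAut M Q) (n : ℕ) (α β : M → Q)
    (h : hammingDist α β = n) : hammingDist (x α) (x β) ≤ n := by
  classical
  induction n generalizing α with
  | zero => simp [hammingDist_eq_zero.1 h]
  | succ n ih =>
    obtain ⟨i, hi⟩ : ∃ i, α i ≠ β i := by
      by_contra! hc
      rw [funext hc, hammingDist_self] at h
      omega
    have h₁ : hammingDist α (Function.update α i (β i)) = 1 := by
      rw [hammingDist, Finset.card_eq_one]
      refine ⟨i, ?_⟩
      ext j
      rcases eq_or_ne j i with rfl | hj <;> simp_all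
    have h₂ : hammingDist (Function.update α i (β i)) β = n := by
      have : ({j | α j ≠ β j} : Finset M).erase i =
          ({j | Function.update α i (β i) j ≠ β j} : Finset M) := by
        ext j
        rcases eq_or_ne j i with rfl | hj <;> simp_all
      rw [hammingDist, ← this, Finset.card_erase_of_mem (by simpa using hi)]
      rw [hammingDist] at h
      omega
    have h₃ : hammingDist (x α) (x (Function.update α i (β i))) = 1 := x.map_rel_iff.2 h₁
    have := hammingDist_triangle (x α) (x (Function.update α i (β i))) (x β)
    have := ih _ h₂
    omega

/-- Automorphisms of the Hamming graph preserve the Hamming distance. -/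
theorem hammingDist_map (x : HammingAut M Q) (α β : M → Q) :
    hammingDist (x α) (x β) = hammingDist α β := by
  refine le_antisymm (hammingDist_map_le x _ α β rfl) ?_
  simpa using hammingDist_map_le x⁻¹ _ (x α) (x β) rfl

theorem map_mem_neighbourSet {C : Set (M → Q)} {x : HammingAut M Q} (hx : x ∈ codeAut C) {r : ℕ}
    {α : M → Q} (hα : α ∈ neighbourSet C r) : x α ∈ neighbourSet C r := by
  have hC : ∀ β, x β ∈ C ↔ β ∈ C := fun β => MulAction.mem_stabilizer_set.1 hx β
  have : {d | ∃ β ∈ C, hammingDist (x α) β = d} = {d | ∃ β ∈ C, hammingDist α β = d} := by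
    ext d
    constructor
    · rintro ⟨β, hβ, rfl⟩
      refine ⟨x⁻¹ β, (hC _).1 (by simpa using hβ), ?_⟩
      rw [← hammingDist_map x, RelIso.apply_inv_self]
    · rintro ⟨β, hβ, rfl⟩
      exact ⟨x β, (hC _).2 hβ, hammingDist_map x α β⟩
  unfold neighbourSet at hα ⊢
  rw [Set.mem_ofPred_eq, this]
  exact hα

theorem neighbourSet_zero (C : Set (M → Q)) : neighbourSet C 0 = C := by
  ext α
  simp [neighbourSet, IsLeast, lowerBounds]

theorem le_coveringRadius {C : Set (M → Q)} {r : ℕ} (h : (neighbourSet C r).Nonempty) :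
    r ≤ coveringRadius C := by
  -- Boundedness is needed: `sSup` of an unbounded set of naturals is 0.
  refine le_csSup ⟨Fintype.card M, ?_⟩ h
  rintro s ⟨α, ⟨β, -, rfl⟩, -⟩
  exact hammingDist_le_card_fintype

end HammingAut

/-! ### Automorphisms of binary Hamming graphs -/

section Binary

variable {M : Type*} [Fintype M]

/-- The automorphism permuting the entries by `σ` and then adding the vector `t`. -/
def signedPerm (σ : Equiv.Perm M) (t : M → ZMod 2) : HammingAut M (ZMod 2) where
  toFun α i := α (σ.symm i) + t i
  invFun α i := α (σ i) - t (σ i)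
  left_inv α := by ext i; simp
  right_inv α := by ext i; simp
  map_rel_iff' {α β} := by
    have : hammingDist (fun i => α (σ.symm i) + t i) (fun i => β (σ.symm i) + t i) =
        hammingDist α β := by
      refine Finset.card_equiv σ.symm fun i => ?_
      simp
    simp only [hammingGraph, Equiv.coe_fn_mk, this]

theorem signedPerm_apply (σ : Equiv.Perm M) (t α : M → ZMod 2) (i : M) :
    signedPerm σ t α i = α (σ.symm i) + t i := rfl

@[simp]
theorem signedPerm_zero (σ : Equiv.Perm M) (t : M → ZMod 2) : signedPerm σ t 0 = t := by
  ext i; simp [signedPerm_apply]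

variable [DecidableEq M]

/-- The characteristic vector of a set of entries. -/
def indicatorVec (S : Finset M) : M → ZMod 2 := fun i => if i ∈ S then 1 else 0

/-- Distances to zero and to the unit vectors determine a vector, so an isometry fixing zero is
determined by how it permutes the unit vectors. -/
theorem hammingDist_single_lt_iff (α : M → ZMod 2) (i : M) :
    hammingDist α (Pi.single i 1) < hammingNorm α ↔ α i = 1 := by
  have h01 : ∀ z : ZMod 2, z ≠ 1 → z = 0 := by decide
  constructor
  · contrapose!
    intro h
    have h0 := h01 _ h
    refine Finset.card_le_card fun j hj => ?_
    rcases eq_or_ne j i with rfl | hji <;> simp_all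
  · intro h
    refine Finset.card_lt_card (Finset.ssubset_iff_of_subset ?_ |>.2 ⟨i, ?_, ?_⟩)
    · intro j hj
      rcases eq_or_ne j i with rfl | hji <;> simp_all
    · simp [h]
    · simp [h]

theorem eq_single_of_hammingNorm_eq_one {α : M → ZMod 2} (h : hammingNorm α = 1) :
    ∃ i, α = Pi.single i 1 := by
  have h01 : ∀ z : ZMod 2, z ≠ 0 → z = 1 := by decide
  obtain ⟨i, hi⟩ := Finset.card_eq_one.1 h
  refine ⟨i, funext fun j => ?_⟩
  have hj := Finset.ext_iff.1 hi j
  rcases eq_or_ne j i with rfl | hji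
  · simp only [Finset.mem_filter, Finset.mem_singleton, Finset.mem_univ, true_and, iff_true] at hj
    simpa using h01 _ hj
  · simpa [hji] using hj

/-- After subtracting `x 0` the map is an isometry fixing zero; it preserves weight, hence permutes
the unit vectors. -/
theorem exists_perm_apply_eq_add (x : HammingAut M (ZMod 2)) :
    ∃ σ : Equiv.Perm M, ∀ α i, x α (σ i) = α i + x 0 (σ i) := by
  have hdist : ∀ α β, hammingDist (x α - x 0) (x β - x 0) = hammingDist α β := fun α β => by
    rw [← hammingDist_map x α β, hammingDist_eq_hammingNorm, hammingDist_eq_hammingNorm]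
    congr 1
    abel
  have hnorm : ∀ α, hammingNorm (x α - x 0) = hammingNorm α := fun α => by
    rw [← hammingDist_zero_right α, ← hdist α 0, sub_self, hammingDist_zero_right]
  have hone : ∀ i : M, hammingNorm (Pi.single i 1 : M → ZMod 2) = 1 := fun i => by
    rw [hammingNorm, Finset.card_eq_one]
    refine ⟨i, ?_⟩
    ext j
    rcases eq_or_ne j i with rfl | hj <;> simp_all
  choose f hf using fun i => eq_single_of_hammingNorm_eq_one ((hnorm (Pi.single i 1)).trans (hone i))
  have hinj : Function.Injective f := by
    intro i j hij
    have := hdist (Pi.single i 1) (Pi.single j 1)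
    rw [hf, hf, hij, hammingDist_self, eq_comm, hammingDist_eq_zero] at this
    by_contra hne
    simpa [hne] using congrFun this i
  refine ⟨Equiv.ofBijective f (Finite.injective_iff_bijective.1 hinj), fun α i => ?_⟩
  have key : (x α - x 0) (f i) = 1 ↔ α i = 1 := by
    rw [← hammingDist_single_lt_iff, ← hammingDist_single_lt_iff, hnorm, ← hf, hdist]
  have h2 : ∀ a b c : ZMod 2, (a - b = 1 ↔ c = 1) → a = c + b := by decide
  exact h2 _ _ _ key

theorem perm_eq_of_apply_eq_add {x : HammingAut M (ZMod 2)} {σ τ : Equiv.Perm M}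
    (hσ : ∀ α i, x α (σ i) = α i + x 0 (σ i)) (hτ : ∀ α i, x α (τ i) = α i + x 0 (τ i)) :
    σ = τ := by
  ext i
  have h₁ := hσ (Pi.single i 1) i
  obtain ⟨j, hj⟩ := τ.surjective (σ i)
  have h₂ := hτ (Pi.single i 1) j
  rw [hj, h₁] at h₂
  by_contra hne
  have hji : j ≠ i := by
    rintro rfl
    exact hne hj.symm
  simp [hji] at h₂

/-- The action of the automorphism group of a binary Hamming graph on the entries. -/
noncomputable def entryPerm : HammingAut M (ZMod 2) →* Equiv.Perm M where
  toFun x := (exists_perm_apply_eq_add x).choose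
  map_one' := perm_eq_of_apply_eq_add (x := 1) (exists_perm_apply_eq_add 1).choose_spec (by simp)
  map_mul' x y := by
    refine perm_eq_of_apply_eq_add (x := x * y) (exists_perm_apply_eq_add (x * y)).choose_spec ?_
    intro α i
    have hx := (exists_perm_apply_eq_add x).choose_spec
    have hy := (exists_perm_apply_eq_add y).choose_spec
    rw [RelIso.mul_apply, RelIso.mul_apply, Equiv.Perm.mul_apply, hx (y α), hx (y 0), hy α, add_assoc]

theorem apply_entryPerm (x : HammingAut M (ZMod 2)) (α : M → ZMod 2) (i : M) :
    x α (entryPerm x i) = α i + x 0 (entryPerm x i) :=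
  (exists_perm_apply_eq_add x).choose_spec α i

theorem entryPerm_eq {x : HammingAut M (ZMod 2)} {σ : Equiv.Perm M}
    (hσ : ∀ α i, x α (σ i) = α i + x 0 (σ i)) : entryPerm x = σ :=
  perm_eq_of_apply_eq_add (apply_entryPerm x) hσ

theorem entryPerm_eq_one_of_mem_baseGroup {x : HammingAut M (ZMod 2)}
    (hx : x ∈ baseGroup M (ZMod 2)) : entryPerm x = 1 := by
  obtain ⟨h, hh⟩ := hx
  refine entryPerm_eq fun α i => ?_
  -- Both permutations of the binary alphabet are translations.
  have key : ∀ (e : Equiv.Perm (ZMod 2)) (z : ZMod 2), e z = z + e 0 := by decide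
  rw [hh, hh]
  exact key _ _

@[simp]
theorem entryPerm_signedPerm (σ : Equiv.Perm M) (t : M → ZMod 2) :
    entryPerm (signedPerm σ t) = σ :=
  entryPerm_eq fun α i => by simp [signedPerm_apply]

theorem eq_of_entryPerm_eq {x y : HammingAut M (ZMod 2)} (h : entryPerm x = entryPerm y)
    (h0 : x 0 = y 0) : x = y := by
  refine RelIso.ext fun α => funext fun i => ?_
  obtain ⟨j, rfl⟩ := (entryPerm x).surjective i
  rw [apply_entryPerm x, h0, h, ← apply_entryPerm y]

/-- The automorphism permuting the entries by `σ`. -/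
def permAut : Equiv.Perm M →* HammingAut M (ZMod 2) where
  toFun σ := signedPerm σ 0
  map_one' := eq_of_entryPerm_eq (by simp) (by simp)
  map_mul' σ τ := eq_of_entryPerm_eq (by simp) (by simp)

@[simp]
theorem entryPerm_permAut (σ : Equiv.Perm M) : entryPerm (permAut σ) = σ :=
  entryPerm_signedPerm σ 0

theorem permAut_apply (σ : Equiv.Perm M) (α : M → ZMod 2) (i : M) :
    permAut σ α i = α (σ.symm i) := by
  simp [permAut, signedPerm_apply]

@[simp]
theorem permAut_zero (σ : Equiv.Perm M) : permAut σ 0 = 0 := signedPerm_zero σ 0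

end Binary

/-! ### The codewords -/

/-- The codewords of the even weight subcode: the zero vector and the translates of the
characteristic vector of the squares of `𝔽₁₁`. -/
def codeword : Option (ZMod 11) → ZMod 11 → ZMod 2
  | none => 0
  | some b => fun a => indicatorVec {0, 1, 3, 4, 5, 9} (a - b)

@[simp]
theorem codeword_none : codeword none = 0 := rfl

theorem codeword_some (b a : ZMod 11) :
    codeword (some b) a = if IsSquare (a - b) then 1 else 0 := by
  have : ∀ a : ZMod 11, indicatorVec {0, 1, 3, 4, 5, 9} a = if IsSquare a then 1 else 0 := by
    decide
  exact this _

theorem hammingDist_codeword : ∀ d e, d ≠ e → hammingDist (codeword d) (codeword e) = 6 := by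
  decide

theorem codeword_injective : Function.Injective codeword := by
  intro d e h
  by_contra hne
  have := hammingDist_codeword d e hne
  rw [h, hammingDist_self] at this
  omega

theorem even_hammingNorm_codeword (d : Option (ZMod 11)) : Even (hammingNorm (codeword d)) := by
  rcases d with _ | b
  · simp
  · rw [← hammingDist_zero_right, ← codeword_none, hammingDist_codeword _ _ (by simp)]
    decide

theorem odd_hammingNorm_one_sub_codeword :
    ∀ d, ¬ Even (hammingNorm (fun a => 1 - codeword d a)) := by
  decide

theorem mem_puncturedHadamardCode_iff (α : ZMod 11 → ZMod 2) :
    α ∈ puncturedHadamardCode ↔ ∃ d, α = codeword d ∨ α = fun a => 1 - codeword d a := by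
  have hsome : ∀ b a : ZMod 11,
      codeword (some b) a = if paleyHadamard (some b) (some a) = 1 then 0 else 1 := by
    intro b a
    rw [codeword_some, paleyHadamard]
    split_ifs <;> simp_all
  have hsome' : ∀ b a : ZMod 11,
      1 - codeword (some b) a = if -paleyHadamard (some b) (some a) = 1 then 0 else 1 := by
    intro b a
    rw [codeword_some, paleyHadamard]
    split_ifs <;> simp_all
  constructor
  · rintro ⟨_, ⟨u, ⟨r, rfl | rfl⟩, h⟩, rfl⟩
    · rcases r with _ | b
      · refine ⟨none, Or.inr (funext fun a => ?_)⟩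
        simp [h, paleyHadamard]
      · refine ⟨some b, Or.inl (funext fun a => ?_)⟩
        rw [hsome]
        exact h _
    · rcases r with _ | b
      · refine ⟨none, Or.inl (funext fun a => ?_)⟩
        simp [h, paleyHadamard]
      · refine ⟨some b, Or.inr (funext fun a => ?_)⟩
        rw [hsome']
        exact h _
  · rintro ⟨_ | b, rfl | rfl⟩
    · exact ⟨_, ⟨-paleyHadamard none, ⟨none, Or.inr rfl⟩, fun _ => rfl⟩,
        funext fun a => by simp [paleyHadamard]⟩
    · exact ⟨_, ⟨paleyHadamard none, ⟨none, Or.inl rfl⟩, fun _ => rfl⟩,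
        funext fun a => by simp [paleyHadamard]⟩
    · exact ⟨_, ⟨paleyHadamard (some b), ⟨some b, Or.inl rfl⟩, fun _ => rfl⟩,
        funext fun a => (hsome b a).symm⟩
    · exact ⟨_, ⟨-paleyHadamard (some b), ⟨some b, Or.inr rfl⟩, fun _ => rfl⟩,
        funext fun a => (hsome' b a).symm⟩

theorem evenHadamardCode_eq_range : evenHadamardCode = Set.range codeword := by
  ext α
  constructor
  · rintro ⟨hα, heven⟩
    obtain ⟨d, rfl | rfl⟩ := (mem_puncturedHadamardCode_iff α).1 hα
    · exact ⟨d, rfl⟩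
    · exact absurd heven (odd_hammingNorm_one_sub_codeword d)
  · rintro ⟨d, rfl⟩
    exact ⟨(mem_puncturedHadamardCode_iff _).2 ⟨d, Or.inl rfl⟩, even_hammingNorm_codeword d⟩

theorem codeword_mem (d : Option (ZMod 11)) : codeword d ∈ evenHadamardCode := by
  rw [evenHadamardCode_eq_range]
  exact ⟨d, rfl⟩

theorem mem_neighbourSet_iff (α : ZMod 11 → ZMod 2) (r : ℕ) :
    α ∈ neighbourSet evenHadamardCode r ↔
      (∃ d, hammingDist α (codeword d) = r) ∧ ∀ d, r ≤ hammingDist α (codeword d) := by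
  simp [evenHadamardCode_eq_range, neighbourSet, IsLeast, lowerBounds]

/-! ### The automorphism group of the code -/

theorem mem_codeAut_iff (x : HammingAut (ZMod 11) (ZMod 2)) :
    x ∈ codeAut evenHadamardCode ↔ ∀ d, ∃ e, x (codeword d) = codeword e := by
  rw [codeAut, evenHadamardCode_eq_range,
    MulAction.mem_stabilizer_set_iff_smul_set_subset (Set.finite_range codeword)]
  constructor
  · intro h d
    obtain ⟨e, he⟩ := h (Set.smul_mem_smul_set ⟨d, rfl⟩)
    exact ⟨e, he.symm⟩
  · rintro h _ ⟨_, ⟨d, rfl⟩, rfl⟩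
    obtain ⟨e, he⟩ := h d
    exact ⟨e, he.symm⟩

theorem exists_codewordPerm {x : HammingAut (ZMod 11) (ZMod 2)}
    (hx : x ∈ codeAut evenHadamardCode) :
    ∃ π : Equiv.Perm (Option (ZMod 11)), ∀ d, x (codeword d) = codeword (π d) := by
  choose f hf using (mem_codeAut_iff x).1 hx
  have hinj : Function.Injective f := fun d e h =>
    codeword_injective (x.injective (by rw [hf, hf, h]))
  exact ⟨Equiv.ofBijective f (Finite.injective_iff_bijective.1 hinj), hf⟩

/-- This excludes nontrivial pure translations, the only possible kernel of the action on entries.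
-/
theorem eq_none_of_codeword_add : ∀ e, (∀ d, ∃ f, codeword d + codeword e = codeword f) →
    e = none := by
  decide

/-- Automorphisms of the code are determined by their action on entries. -/
theorem eq_one_of_entryPerm_eq_one {x : HammingAut (ZMod 11) (ZMod 2)}
    (hx : x ∈ codeAut evenHadamardCode) (h : entryPerm x = 1) : x = 1 := by
  have hadd : ∀ α, x α = α + x 0 := fun α => funext fun i => by
    simpa [h] using apply_entryPerm x α i
  rw [mem_codeAut_iff] at hx
  obtain ⟨e, he⟩ := hx none
  rw [codeword_none] at he
  have : e = none := eq_none_of_codeword_add e fun d => by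
    obtain ⟨f, hf⟩ := hx d
    exact ⟨f, by rw [← hf, hadd, he]⟩
  refine eq_of_entryPerm_eq (by rw [h, map_one]) ?_
  rw [he, this]
  rfl

theorem isEntryFaithful_codeAut : IsEntryFaithful (codeAut evenHadamardCode) := by
  rw [IsEntryFaithful, eq_bot_iff]
  rintro x ⟨hx, hN⟩
  exact eq_one_of_entryPerm_eq_one hx (entryPerm_eq_one_of_mem_baseGroup hN)

/-! ### The neighbours at distance three -/

theorem card_codeword_dist_map {x : HammingAut (ZMod 11) (ZMod 2)}
    (hx : x ∈ codeAut evenHadamardCode) (α : ZMod 11 → ZMod 2) (r : ℕ) :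
    Finset.card {d | hammingDist (x α) (codeword d) = r} =
      Finset.card {d | hammingDist α (codeword d) = r} := by
  obtain ⟨π, hπ⟩ := exists_codewordPerm hx
  refine (Finset.card_equiv π fun d => ?_).symm
  simp [← hπ, hammingDist_map]

theorem indicatorVec_mem_neighbourSet_three :
    indicatorVec {0, 1, 2} ∈ neighbourSet evenHadamardCode 3 :=
  (mem_neighbourSet_iff _ _).2 (by decide)

theorem not_isNeighbourTransitive_three (X : Subgroup (HammingAut (ZMod 11) (ZMod 2))) :
    ¬ IsNeighbourTransitive X 3 evenHadamardCode := by
  rintro ⟨hX, h⟩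
  obtain ⟨α, hα⟩ := h 3 le_rfl
  have h₁ : indicatorVec {0, 1, 2} ∈ MulAction.orbit X α :=
    hα ▸ indicatorVec_mem_neighbourSet_three
  have h₂ : indicatorVec {0, 2, 3} ∈ MulAction.orbit X α :=
    hα ▸ (mem_neighbourSet_iff _ _).2 (by decide)
  -- The triples {0,1,2} and {0,2,3} lie in one and two blocks respectively. Together with zero this
  -- makes two and three codewords at distance 3, a count that automorphisms preserve.
  rw [← MulAction.orbit_eq_iff.2 h₁] at h₂
  obtain ⟨x, hx⟩ := h₂
  have key := card_codeword_dist_map (hX x.2) (indicatorVec {0, 1, 2}) 3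
  have hx' : (x : HammingAut (ZMod 11) (ZMod 2)) (indicatorVec {0, 1, 2}) =
      indicatorVec {0, 2, 3} := hx
  rw [hx'] at key
  exact absurd key (by decide)

theorem not_isCompletelyTransitive (X : Subgroup (HammingAut (ZMod 11) (ZMod 2))) :
    ¬ IsCompletelyTransitive X evenHadamardCode := fun h =>
  not_isNeighbourTransitive_three X ⟨h.1, fun i hi =>
    h.2 i (hi.trans (le_coveringRadius ⟨_, indicatorVec_mem_neighbourSet_three⟩))⟩

/-! ### Generators of the automorphism group -/

/-- The second standard generator of the Mathieu group, acting on `𝔽₁₁`. -/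
def mathieuGen : Equiv.Perm (ZMod 11) :=
  List.formPerm [2, 6, 10, 7] * List.formPerm [3, 9, 4, 5]

theorem mathieuM11_eq_closure :
    mathieuM11 = Subgroup.closure {Equiv.addRight (1 : ZMod 11), mathieuGen} := by
  have h₁ : finRotate 11 = Equiv.addRight (1 : ZMod 11) := by
    apply Equiv.ext; decide
  -- `ZMod 11` unfolds to `Fin 11`, so both sides live in the same group.
  exact congrArg (fun σ : Equiv.Perm (ZMod 11) => Subgroup.closure {σ, mathieuGen}) h₁

/-- The automorphism of the code that acts on entries as the second standard generator. -/
def mathieuGenAut : HammingAut (ZMod 11) (ZMod 2) := signedPerm mathieuGen (codeword (some 0))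

/-- The subgroup of the automorphism group of the Hamming graph generated by the translation and
by the second standard generator of the Mathieu group. -/
def mathieuAut : Subgroup (HammingAut (ZMod 11) (ZMod 2)) :=
  Subgroup.closure {permAut (Equiv.addRight 1), mathieuGenAut}

theorem mathieuGenAut_mem : mathieuGenAut ∈ mathieuAut := Subgroup.subset_closure (by simp)

theorem permAut_addRight_mem (b : ZMod 11) : permAut (Equiv.addRight b) ∈ mathieuAut := by
  have h : permAut (Equiv.addRight (1 : ZMod 11)) ∈ mathieuAut := Subgroup.subset_closure (by simp)
  have := mathieuAut.pow_mem h b.val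
  have hpow : ∀ n : ℕ, Equiv.addRight (1 : ZMod 11) ^ n = Equiv.addRight (n : ZMod 11) := by
    intro n
    induction n with
    | zero => simp
    | succ n ih =>
      refine Equiv.ext fun i => ?_
      simp [pow_succ', ih, add_assoc]
  rwa [← map_pow, hpow, ZMod.natCast_zmod_val] at this

theorem permAut_addRight_codeword (b : ZMod 11) (d : Option (ZMod 11)) :
    permAut (Equiv.addRight b) (codeword d) = codeword (d.map (· + b)) := by
  rcases d with _ | c
  · simp
  · ext i
    rw [permAut_apply, Option.map_some, codeword_some, codeword_some,
      show i - (c + b) = i - b - c by ring, sub_eq_add_neg i b]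
    simp

theorem mathieuGenAut_codeword :
    ∀ d, ∃ e, mathieuGenAut (codeword d) = codeword e := by
  have : ∀ d, ∃ e, ∀ i, codeword d (mathieuGen.symm i) + codeword (some 0) i = codeword e i := by
    decide
  intro d
  obtain ⟨e, he⟩ := this d
  exact ⟨e, funext he⟩

theorem mathieuAut_le_codeAut : mathieuAut ≤ codeAut evenHadamardCode := by
  rw [mathieuAut, Subgroup.closure_le]
  rintro x (rfl | rfl)
  · exact (mem_codeAut_iff _).2 fun d => ⟨_, permAut_addRight_codeword 1 d⟩
  · exact (mem_codeAut_iff _).2 mathieuGenAut_codeword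

theorem exists_mem_mathieuAut_apply_zero (d : Option (ZMod 11)) :
    ∃ x ∈ mathieuAut, x 0 = codeword d := by
  rcases d with _ | b
  · exact ⟨1, one_mem _, rfl⟩
  · refine ⟨permAut (Equiv.addRight b) * mathieuGenAut,
      mul_mem (permAut_addRight_mem b) mathieuGenAut_mem, ?_⟩
    rw [RelIso.mul_apply, mathieuGenAut, signedPerm_zero, permAut_addRight_codeword]
    simp

/-- The generator preserves the set of squares, so its signed form swaps zero with `codeword (some
0)` and the square fixes zero. -/
theorem permAut_mathieuGen_sq_mem : permAut (mathieuGen ^ 2) ∈ mathieuAut := by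
  have h : permAut (mathieuGen ^ 2) = mathieuGenAut ^ 2 := by
    refine eq_of_entryPerm_eq (by simp [mathieuGenAut]) ?_
    have : ∀ i, codeword (some 0) (mathieuGen.symm i) + codeword (some 0) i = 0 := by decide
    rw [permAut_zero, pow_two, RelIso.mul_apply, mathieuGenAut, signedPerm_zero]
    exact (funext this).symm
  rw [h]
  exact pow_mem mathieuGenAut_mem 2

/-- A word in the translations and the square of the second generator of the Mathieu group. -/
def biplaneWord (i j k : ZMod 11) : Equiv.Perm (ZMod 11) :=
  Equiv.addRight i * mathieuGen ^ 2 * Equiv.addRight j * mathieuGen ^ 2 * Equiv.addRight k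

theorem permAut_biplaneWord_mem (i j k : ZMod 11) : permAut (biplaneWord i j k) ∈ mathieuAut := by
  simp only [biplaneWord, map_mul]
  have := permAut_mathieuGen_sq_mem
  have := permAut_addRight_mem
  exact mul_mem (mul_mem (mul_mem (mul_mem (this i) ‹_›) (this j)) ‹_›) (this k)

set_option maxRecDepth 10000 in
theorem exists_mem_mathieuAut_of_ne {a b : ZMod 11} (h : a ≠ b) :
    ∃ σ : Equiv.Perm (ZMod 11), permAut σ ∈ mathieuAut ∧ σ 0 = a ∧ σ 1 = b := by
  have key : ∀ c : ZMod 11, c ≠ 0 →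
      -- Explicit words provide the images of 1 under the stabiliser of 0; a translation does the
      -- rest. Since `mathieuGen ^ 4 = 1`, the triple (0, 0, 0) is the identity.
      ∃ w ∈ ([(0, 0, 0), (0, 4, 6), (1, 5, 8), (1, 7, 7), (0, 2, 5), (2, 3, 10), (0, 8, 4),
        (0, 3, 8), (0, 1, 2), (0, 5, 7)] : List (ZMod 11 × ZMod 11 × ZMod 11)),
        biplaneWord w.1 w.2.1 w.2.2 0 = 0 ∧ biplaneWord w.1 w.2.1 w.2.2 1 = c := by
    decide
  obtain ⟨w, -, h₀, h₁⟩ := key (b - a) (sub_ne_zero.2 h.symm)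
  refine ⟨Equiv.addRight a * biplaneWord w.1 w.2.1 w.2.2, ?_, ?_, ?_⟩
  · rw [map_mul]
    exact mul_mem (permAut_addRight_mem a) (permAut_biplaneWord_mem _ _ _)
  · simp [h₀]
  · simp [h₁]

set_option maxRecDepth 10000 in
theorem exists_mem_mathieuAut_fixing {c : ZMod 11}
    (h : c ∈ ({2, 3, 4, 6, 7, 10} : Finset (ZMod 11))) :
    ∃ σ : Equiv.Perm (ZMod 11), permAut σ ∈ mathieuAut ∧ σ 0 = 0 ∧ σ 1 = 1 ∧ σ 2 = c := by
  have key : ∀ c ∈ ({2, 3, 4, 6, 7, 10} : Finset (ZMod 11)),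
      ∃ w ∈ ([(0, 0, 0), (1, 4, 5), (2, 8, 8), (5, 3, 3), (3, 3, 9), (1, 1, 1)] :
        List (ZMod 11 × ZMod 11 × ZMod 11)),
        biplaneWord w.1 w.2.1 w.2.2 0 = 0 ∧ biplaneWord w.1 w.2.1 w.2.2 1 = 1 ∧
          biplaneWord w.1 w.2.1 w.2.2 2 = c := by
    decide
  obtain ⟨w, -, hw⟩ := key c h
  exact ⟨_, permAut_biplaneWord_mem _ _ _, hw⟩

/-! ### The automorphism group is generated by these two elements -/

/-- The number of codewords that take the value `1` at three given entries. -/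
def tripleCount (i j k : ZMod 11) : ℕ :=
  Finset.card {d | codeword d i = 1 ∧ codeword d j = 1 ∧ codeword d k = 1}

theorem tripleCount_entryPerm {x : HammingAut (ZMod 11) (ZMod 2)}
    (hx : x ∈ codeAut evenHadamardCode) (h0 : x 0 = 0) (i j k : ZMod 11) :
    tripleCount (entryPerm x i) (entryPerm x j) (entryPerm x k) = tripleCount i j k := by
  obtain ⟨π, hπ⟩ := exists_codewordPerm hx
  refine (Finset.card_equiv π fun d => ?_).symm
  have : ∀ i, codeword (π d) (entryPerm x i) = codeword d i := fun i => by
    rw [← hπ, apply_entryPerm, h0]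
    simp
  simp [this]

/-- An automorphism of the code that fixes the zero vector and the entries `0`, `1`, `2` is
trivial. -/
theorem eq_one_of_fixes {x : HammingAut (ZMod 11) (ZMod 2)}
    (hx : x ∈ codeAut evenHadamardCode) (hx0 : x 0 = 0) (h0 : entryPerm x 0 = 0)
    (h1 : entryPerm x 1 = 1) (h2 : entryPerm x 2 = 2) : x = 1 := by
  refine eq_one_of_entryPerm_eq_one hx ?_
  have hn := tripleCount_entryPerm hx hx0
  have h01 := fun i => hn 0 1 i
  have h02 := fun i => hn 0 2 i
  have h12 := fun i => hn 1 2 i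
  rw [h0, h1] at h01
  rw [h0, h2] at h02
  rw [h1, h2] at h12
  -- Block counts with pairs from {0, 1, 2} separate all entries except 4 and 7. So 3 is fixed too,
  -- and counts with 0 and 3 then separate 4 from 7.
  have refine₁ : ∀ i j, tripleCount 0 1 j = tripleCount 0 1 i → tripleCount 0 2 j = tripleCount 0 2 i →
      tripleCount 1 2 j = tripleCount 1 2 i → j = i ∨ (i = 4 ∨ i = 7) ∧ (j = 4 ∨ j = 7) := by
    decide
  have h3 : entryPerm x 3 = 3 := by
    have := refine₁ 3 _ (h01 3) (h02 3) (h12 3)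
    exact this.resolve_right fun h => absurd h.1 (by decide)
  have h03 := fun i => hn 0 3 i
  rw [h0, h3] at h03
  have refine₂ : ∀ i j, (i = 4 ∨ i = 7) ∧ (j = 4 ∨ j = 7) → tripleCount 0 3 j = tripleCount 0 3 i →
      j = i := by
    decide
  refine Equiv.ext fun i => ?_
  exact ((refine₁ i _ (h01 i) (h02 i) (h12 i)).elim id fun h => refine₂ _ _ h (h03 i))

theorem codeAut_eq_mathieuAut : codeAut evenHadamardCode = mathieuAut := by
  refine le_antisymm (fun g hg => ?_) mathieuAut_le_codeAut
  have hle := mathieuAut_le_codeAut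
  -- Modulo `mathieuAut`, `g` is successively made to fix the zero word, the entries 0 and 1, and
  -- the entry 2.
  obtain ⟨d, hd⟩ := (mem_codeAut_iff g).1 hg none
  obtain ⟨k, hk, hkd⟩ := exists_mem_mathieuAut_apply_zero d
  rw [← mathieuAut.mul_mem_cancel_left (inv_mem hk)]
  replace hg := mul_mem (inv_mem (hle hk)) hg
  have hg0 : (k⁻¹ * g) 0 = 0 := by
    rw [codeword_none] at hd
    rw [RelIso.mul_apply, hd, ← hkd, RelIso.inv_apply_self]
  generalize k⁻¹ * g = g at hg hg0
  clear hd hkd hk k d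
  obtain ⟨σ, hσ, h0, h1⟩ := exists_mem_mathieuAut_of_ne
    ((entryPerm g).injective.ne (show (0 : ZMod 11) ≠ 1 by decide))
  rw [← mathieuAut.mul_mem_cancel_left (inv_mem hσ)]
  replace hg := mul_mem (inv_mem (hle hσ)) hg
  rw [← map_inv] at hg ⊢
  replace hg0 : (permAut σ⁻¹ * g) 0 = 0 := by rw [RelIso.mul_apply, hg0, permAut_zero]
  replace h0 : entryPerm (permAut σ⁻¹ * g) 0 = 0 := by simp [← h0]
  replace h1 : entryPerm (permAut σ⁻¹ * g) 1 = 1 := by simp [← h1]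
  generalize permAut σ⁻¹ * g = g at hg hg0 h0 h1
  clear hσ σ
  have hc : entryPerm g 2 ∈ ({2, 3, 4, 6, 7, 10} : Finset (ZMod 11)) := by
    have := tripleCount_entryPerm hg hg0 0 1 2
    rw [h0, h1] at this
    have key : ∀ c, tripleCount 0 1 c = tripleCount 0 1 2 →
      c ∈ ({2, 3, 4, 6, 7, 10} : Finset (ZMod 11)) := by decide
    exact key _ this
  obtain ⟨σ, hσ, hσ0, hσ1, hσ2⟩ := exists_mem_mathieuAut_fixing hc
  rw [← mathieuAut.mul_mem_cancel_left (inv_mem hσ)]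
  have hone : (permAut σ)⁻¹ * g = 1 := by
    refine eq_one_of_fixes (mul_mem (inv_mem (hle hσ)) hg) ?_ ?_ ?_ ?_
    · rw [← map_inv, RelIso.mul_apply, hg0, permAut_zero]
    · simp [h0, Equiv.symm_apply_eq, hσ0]
    · simp [h1, Equiv.symm_apply_eq, hσ1]
    · simp [Equiv.symm_apply_eq, hσ2]
  rw [hone]
  exact one_mem _

theorem nonempty_codeAut_mulEquiv : Nonempty (codeAut evenHadamardCode ≃* mathieuM11) := by
  let f := entryPerm.comp (codeAut evenHadamardCode).subtype
  have hf : Function.Injective f := (injective_iff_map_eq_one f).2 fun x hx =>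
    Subtype.ext (eq_one_of_entryPerm_eq_one x.2 hx)
  have hrange : f.range = mathieuM11 := by
    rw [mathieuM11_eq_closure, MonoidHom.range_comp, Subgroup.range_subtype, codeAut_eq_mathieuAut,
      mathieuAut, MonoidHom.map_closure, Set.image_pair, entryPerm_permAut, mathieuGenAut,
      entryPerm_signedPerm]
  exact ⟨(MonoidHom.ofInjective hf).trans (MulEquiv.subgroupCongr hrange)⟩

/-! ### Neighbour transitivity of the automorphism group -/

section Indicator

variable {M : Type*} [DecidableEq M]

theorem indicatorVec_injective : Function.Injective (indicatorVec : Finset M → M → ZMod 2) := by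
  intro S T h
  ext i
  have := congrFun h i
  by_cases hS : i ∈ S <;> by_cases hT : i ∈ T <;> simp_all [indicatorVec]

variable [Fintype M]

theorem hammingDist_add_indicatorVec (α : M → ZMod 2) (S : Finset M) :
    hammingDist (α + indicatorVec S) α = S.card := by
  simp [hammingDist, indicatorVec]

theorem eq_add_indicatorVec (α β : M → ZMod 2) :
    α = β + indicatorVec {i | α i ≠ β i} := by
  have h : ∀ a b : ZMod 2, a = b + if a ≠ b then 1 else 0 := by decide
  ext i
  simpa [indicatorVec] using h (α i) (β i)

theorem permAut_indicatorVec (σ : Equiv.Perm M) (S : Finset M) :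
    permAut σ (indicatorVec S) = indicatorVec (S.image σ) := by
  ext i
  obtain ⟨j, rfl⟩ := σ.surjective i
  simp [permAut_apply, indicatorVec]

end Indicator

theorem exists_perm_image_eq {r : ℕ} (hr : r ≤ 2) :
    ∃ S₀ : Finset (ZMod 11), S₀.card = r ∧ ∀ S : Finset (ZMod 11), S.card = r →
      ∃ σ : Equiv.Perm (ZMod 11), permAut σ ∈ mathieuAut ∧ S₀.image σ = S := by
  interval_cases r
  · refine ⟨∅, rfl, fun S hS => ⟨1, ?_, ?_⟩⟩
    · rw [map_one]
      exact one_mem _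
    · simp [Finset.card_eq_zero.1 hS]
  · refine ⟨{0}, rfl, fun S hS => ?_⟩
    obtain ⟨a, rfl⟩ := Finset.card_eq_one.1 hS
    exact ⟨_, permAut_addRight_mem a, by simp⟩
  · refine ⟨{0, 1}, rfl, fun S hS => ?_⟩
    obtain ⟨a, b, hab, rfl⟩ := Finset.card_eq_two.1 hS
    obtain ⟨σ, hσ, h0, h1⟩ := exists_mem_mathieuAut_of_ne hab
    exact ⟨σ, hσ, by simp [h0, h1]⟩

/-- Codewords are 6 apart, so a vector within 3 of one codeword is at least 3 from every other. -/
theorem add_indicatorVec_mem_neighbourSet (d : Option (ZMod 11)) {S : Finset (ZMod 11)}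
    (hS : S.card ≤ 3) : codeword d + indicatorVec S ∈ neighbourSet evenHadamardCode S.card := by
  refine (mem_neighbourSet_iff _ _).2 ⟨⟨d, hammingDist_add_indicatorVec _ _⟩, fun e => ?_⟩
  rcases eq_or_ne d e with rfl | hne
  · exact (hammingDist_add_indicatorVec _ _).ge
  · have h₁ := hammingDist_triangle_left (codeword d) (codeword e) (codeword d + indicatorVec S)
    rw [hammingDist_codeword d e hne, hammingDist_add_indicatorVec] at h₁
    omega

theorem isNeighbourTransitive_codeAut :
    IsNeighbourTransitive (codeAut evenHadamardCode) 2 evenHadamardCode := by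
  refine ⟨le_rfl, fun r hr => ?_⟩
  obtain ⟨S₀, hS₀, hS⟩ := exists_perm_image_eq hr
  have hmem : indicatorVec S₀ ∈ neighbourSet evenHadamardCode r := by
    have := add_indicatorVec_mem_neighbourSet none (S := S₀) (by omega)
    rwa [hS₀, codeword_none, zero_add] at this
  refine ⟨indicatorVec S₀, Set.Subset.antisymm (fun α hα => ?_) ?_⟩
  · obtain ⟨⟨d, hd⟩, -⟩ := (mem_neighbourSet_iff _ _).1 hα
    -- Move the nearest codeword to zero, then move the support by an automorphism fixing zero.
    obtain ⟨x, hx, hx0⟩ := exists_mem_mathieuAut_apply_zero d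
    have hnorm : hammingDist (x⁻¹ α) 0 = r := by
      rw [← hammingDist_map x, RelIso.apply_inv_self, hx0, hd]
    obtain ⟨σ, hσ, hσS⟩ := hS {i | x⁻¹ α i ≠ (0 : ZMod 11 → ZMod 2) i} hnorm
    refine ⟨⟨x * permAut σ, mathieuAut_le_codeAut (mul_mem hx hσ)⟩, ?_⟩
    change (x * permAut σ) (indicatorVec S₀) = α
    have h := eq_add_indicatorVec (x⁻¹ α) 0
    rw [zero_add] at h
    rw [RelIso.mul_apply, permAut_indicatorVec, hσS, ← h, RelIso.apply_inv_self]
  · rintro _ ⟨x, rfl⟩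
    exact map_mem_neighbourSet x.2 hmem

/-! ### Every group acting transitively on the neighbours is the full automorphism group -/

/-- Spheres of radius 2 about the codewords are disjoint because 2 + 2 < 6, so the count is 12 · 55.
-/
theorem card_neighbourSet_two : Nat.card (neighbourSet evenHadamardCode 2) = 660 := by
  let f : Option (ZMod 11) × Finset.powersetCard 2 (Finset.univ : Finset (ZMod 11)) →
      ZMod 11 → ZMod 2 := fun p => codeword p.1 + indicatorVec p.2.1
  have hf : Function.Injective f := by
    rintro ⟨d, S, hS⟩ ⟨e, T, hT⟩ h
    replace h : codeword d + indicatorVec S = codeword e + indicatorVec T := h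
    have hde : d = e := by
      by_contra hne
      have h₁ := hammingDist_triangle_left (codeword d) (codeword e) (codeword d + indicatorVec S)
      rw [hammingDist_codeword d e hne, hammingDist_add_indicatorVec, h,
        hammingDist_add_indicatorVec, (Finset.mem_powersetCard.1 hS).2,
        (Finset.mem_powersetCard.1 hT).2] at h₁
      omega
    subst hde
    have := indicatorVec_injective (add_left_cancel h)
    simp [this]
  have hrange : Set.range f = neighbourSet evenHadamardCode 2 := by
    ext α
    constructor
    · rintro ⟨⟨d, S, hS⟩, rfl⟩
      have hS2 := (Finset.mem_powersetCard.1 hS).2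
      have := add_indicatorVec_mem_neighbourSet d (S := S) (by omega)
      rwa [hS2] at this
    · intro hα
      obtain ⟨⟨d, hd⟩, -⟩ := (mem_neighbourSet_iff _ _).1 hα
      let S : Finset (ZMod 11) := {i | α i ≠ codeword d i}
      have hS : S ∈ Finset.powersetCard 2 Finset.univ :=
        Finset.mem_powersetCard.2 ⟨Finset.subset_univ _, hd⟩
      exact ⟨(d, ⟨S, hS⟩), (eq_add_indicatorVec _ _).symm⟩
  rw [← hrange, Nat.card_range_of_injective hf, Nat.card_eq_fintype_card, Fintype.card_prod,
    Fintype.card_option, Fintype.card_coe, Finset.card_powersetCard, Finset.card_univ, ZMod.card]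
  rfl

theorem card_evenHadamardCode : Nat.card evenHadamardCode = 12 := by
  rw [evenHadamardCode_eq_range, Nat.card_range_of_injective codeword_injective]
  simp

/-- An automorphism is determined by the image of zero and of three entries: 12 · 11 · 10 · 9. This
crude bound suffices, since 11880 / 1980 = 6 < 11. -/
theorem card_codeAut_le : Nat.card (codeAut evenHadamardCode) ≤ 11880 := by
  have hex : ∀ x : codeAut evenHadamardCode, ∃ d, x.1 0 = codeword d := fun x =>
    (mem_codeAut_iff x.1).1 x.2 none
  choose z hz using hex
  let base : Fin 3 ↪ ZMod 11 := ⟨![0, 1, 2], by decide⟩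
  let f : codeAut evenHadamardCode → Option (ZMod 11) × (Fin 3 ↪ ZMod 11) := fun x =>
    (z x, base.trans (entryPerm x.1).toEmbedding)
  have hf : Function.Injective f := by
    intro x y h
    have hd : z x = z y := congrArg Prod.fst h
    have he : ∀ i, entryPerm x.1 (base i) = entryPerm y.1 (base i) := fun i =>
      DFunLike.congr_fun (congrArg Prod.snd h) i
    have hfix : ∀ i, entryPerm (y⁻¹ * x).1 (base i) = base i := fun i => by simp [he]
    have h1 : (y⁻¹ * x).1 = 1 := by
      refine eq_one_of_fixes (y⁻¹ * x).2 ?_ (hfix 0) (hfix 1) (hfix 2)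
      rw [Subgroup.coe_mul, RelIso.mul_apply, hz, hd, ← hz, Subgroup.coe_inv,
        RelIso.inv_apply_self]
    exact (inv_mul_eq_one.1 (Subtype.ext h1)).symm
  refine (Nat.card_le_card_of_injective f hf).trans ?_
  rw [Nat.card_eq_fintype_card, Fintype.card_prod, Fintype.card_embedding_eq]
  simp [ZMod.card]

/-- The sign of an element of the binary alphabet. -/
def binarySign (z : ZMod 2) : ℤ := if z = 0 then 1 else -1

theorem binarySign_add : ∀ y z, binarySign (y + z) = binarySign y * binarySign z := by
  decide

/-- In signs the codewords are orthogonal rows of a Hadamard matrix with an all-one column deleted.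
-/
theorem sum_binarySign_rows : ∀ d e, d ≠ e →
    ∑ a, binarySign (codeword d a) * binarySign (codeword e a) = -1 := by
  decide

theorem sum_binarySign_columns : ∀ a b,
    ∑ d, binarySign (codeword d a) * binarySign (codeword d b) = if a = b then 12 else 0 := by
  decide

/-- An automorphism of the code of order three fixes a codeword: the codewords span a regular
simplex, so that the number of fixed codewords is one more than the trace of the automorphism on
`ℝ¹¹`. -/
theorem exists_fixed_codeword {x : HammingAut (ZMod 11) (ZMod 2)}
    (hx : x ∈ codeAut evenHadamardCode) (h3 : x ^ 3 = 1) : ∃ d, x (codeword d) = codeword d := by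
  by_contra! hne
  obtain ⟨π, hπ⟩ := exists_codewordPerm hx
  have hrow : ∑ d, ∑ a, binarySign (codeword d a) * binarySign (codeword (π d) a) = -12 := by
    rw [Finset.sum_congr rfl fun d _ => sum_binarySign_rows d (π d) fun h => hne d (by
      rw [hπ, ← h])]
    simp
  -- At a fixed entry the sign of `x` has cube 1, so it is trivial; the trace is then nonnegative,
  -- contradicting -12.
  have hsign : ∀ a, entryPerm x a = a → x 0 a = 0 := by
    intro a ha
    have h : ∀ α, x α a = α a + x 0 a := fun α => by simpa [ha] using apply_entryPerm x α a
    have h0 : (x ^ 3) 0 a = x 0 a + x 0 a + x 0 a := by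
      rw [pow_succ, pow_two, RelIso.mul_apply, RelIso.mul_apply, h, h]
    rw [h3] at h0
    have h2 : ∀ z : ZMod 2, 0 = z + z + z → z = 0 := by decide
    exact h2 _ h0
  have hcol : ∑ d, ∑ a, binarySign (codeword d a) * binarySign (codeword (π d) a) =
      ∑ a, if entryPerm x a = a then 12 else 0 := by
    rw [Finset.sum_comm, ← Equiv.sum_comp (entryPerm x)]
    refine Finset.sum_congr rfl fun a _ => ?_
    have : ∀ d, binarySign (codeword d (entryPerm x a)) *
        binarySign (codeword (π d) (entryPerm x a)) =
        binarySign (codeword d (entryPerm x a)) * binarySign (codeword d a) *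
          binarySign (x 0 (entryPerm x a)) := fun d => by
      rw [← hπ, apply_entryPerm x (codeword d), binarySign_add, mul_assoc]
    simp only [this, ← Finset.sum_mul, sum_binarySign_columns]
    split_ifs with ha
    · rw [ha, hsign a ha]
      rfl
    · simp
  have hnonneg : (0 : ℤ) ≤ ∑ a, if entryPerm x a = a then 12 else 0 :=
    Finset.sum_nonneg fun a _ => by split_ifs <;> norm_num
  omega

set_option maxRecDepth 10000 in
-- The translation and its product with the second generator both have eleventh power 1, and
-- together they generate the group.
theorem codeAut_le_of_forall_pow_eq_one {X : Subgroup (HammingAut (ZMod 11) (ZMod 2))}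
    (hX : ∀ x ∈ codeAut evenHadamardCode, x ^ 11 = 1 → x ∈ X) : codeAut evenHadamardCode ≤ X := by
  have hr : permAut (Equiv.addRight (1 : ZMod 11)) ∈ X := by
    refine hX _ (mathieuAut_le_codeAut (permAut_addRight_mem 1)) ?_
    have : Equiv.addRight (1 : ZMod 11) ^ 11 = 1 := by
      apply Equiv.ext; decide
    rw [← map_pow, this, map_one]
  have hrs : permAut (Equiv.addRight (1 : ZMod 11)) * mathieuGenAut ∈ X := by
    have hmem : permAut (Equiv.addRight (1 : ZMod 11)) * mathieuGenAut ∈ codeAut evenHadamardCode :=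
      mathieuAut_le_codeAut (mul_mem (permAut_addRight_mem 1) mathieuGenAut_mem)
    refine hX _ hmem (eq_one_of_entryPerm_eq_one (pow_mem hmem 11) ?_)
    rw [map_pow, map_mul, entryPerm_permAut, mathieuGenAut, entryPerm_signedPerm]
    apply Equiv.ext
    decide
  rw [codeAut_eq_mathieuAut, mathieuAut, Subgroup.closure_le]
  rintro x (rfl | rfl)
  · exact hr
  · exact (X.mul_mem_cancel_left hr).1 hrs

theorem dvd_card_of_isNeighbourTransitive {X : Subgroup (HammingAut (ZMod 11) (ZMod 2))}
    (h : IsNeighbourTransitive X 2 evenHadamardCode) : 1980 ∣ Nat.card X := by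
  have horbit : ∀ α : ZMod 11 → ZMod 2, Nat.card (MulAction.orbit X α) *
      Nat.card (MulAction.stabilizer X α) = Nat.card X := fun α => by
    rw [← Nat.card_prod]
    exact Nat.card_congr (MulAction.orbitProdStabilizerEquivGroup X α)
  have h660 : 660 ∣ Nat.card X := by
    obtain ⟨α, hα⟩ := h.2 2 le_rfl
    rw [← card_neighbourSet_two, hα]
    exact ⟨_, (horbit α).symm⟩
  obtain ⟨x, hx⟩ := exists_prime_orderOf_dvd_card' (G := X) 3 (Dvd.dvd.trans (by norm_num) h660)
  have hx3 : x ^ 3 = 1 := by rw [← hx, pow_orderOf_eq_one]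
  obtain ⟨d, hd⟩ := exists_fixed_codeword (h.1 x.2) (by rw [← Subgroup.coe_pow, hx3]; rfl)
  have hstab : 3 ∣ Nat.card (MulAction.stabilizer X (codeword d)) := by
    have := orderOf_dvd_natCard (⟨x, hd⟩ : MulAction.stabilizer X (codeword d))
    rwa [← Subgroup.orderOf_coe, hx] at this
  have h36 : 12 * 3 ∣ Nat.card X := by
    obtain ⟨α, hα⟩ := h.2 0 (by norm_num)
    rw [neighbourSet_zero] at hα
    have hdα : codeword d ∈ MulAction.orbit X α := hα ▸ codeword_mem d
    rw [← horbit (codeword d), MulAction.orbit_eq_iff.2 hdα, ← hα, card_evenHadamardCode]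
    exact Nat.mul_dvd_mul_left 12 hstab
  -- 1980 is the least common multiple of 660 and 36.
  omega

theorem eq_codeAut_of_isNeighbourTransitive {X : Subgroup (HammingAut (ZMod 11) (ZMod 2))}
    (h : IsNeighbourTransitive X 2 evenHadamardCode) : X = codeAut evenHadamardCode := by
  refine le_antisymm h.1 (codeAut_le_of_forall_pow_eq_one fun y hy hy11 => ?_)
  let Y := X.subgroupOf (codeAut evenHadamardCode)
  have hcard : Nat.card Y = Nat.card X := Nat.card_congr (Subgroup.subgroupOfEquivOfLe h.1).toEquiv
  have hindex : Y.index < 11 := by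
    by_contra! hge
    have h₁ := Y.card_mul_index
    have h₂ := card_codeAut_le
    have h₃ := Nat.le_of_dvd Nat.card_pos (dvd_card_of_isNeighbourTransitive h)
    have h₄ := Nat.mul_le_mul h₃ hge
    rw [hcard] at h₁
    omega
  -- Some power `y ^ n` with 0 < `n` ≤ index < 11 lies in `X`; as `n` is prime to 11, `y` is a power
  -- of it.
  obtain ⟨n, hn0, hn, hmem⟩ := Subgroup.exists_pow_mem_of_index_ne_zero
    (H := Y) Subgroup.FiniteIndex.index_ne_zero ⟨y, hy⟩
  have hyn : y ^ n ∈ X := hmem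
  have hcop : n.Coprime (orderOf y) :=
    Nat.Coprime.coprime_dvd_right (orderOf_dvd_of_pow_eq_one hy11)
      ((Nat.coprime_of_lt_prime hn0.ne' (by omega) (by norm_num)).symm)
  obtain ⟨m, hm⟩ := exists_pow_eq_self_of_coprime hcop
  rw [← hm]
  exact pow_mem hyn m

theorem lemma4p2 :
    (∀ X : Subgroup (HammingAut (ZMod 11) (ZMod 2)),
      (IsNeighbourTransitive X 2 evenHadamardCode ∧ IsEntryFaithful X) ↔
        X = codeAut evenHadamardCode) ∧
    Nonempty (codeAut evenHadamardCode ≃* mathieuM11) ∧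
    IsEntryFaithful (codeAut evenHadamardCode) ∧
    (∀ X : Subgroup (HammingAut (ZMod 11) (ZMod 2)),
      ¬ IsNeighbourTransitive X 3 evenHadamardCode) ∧
    (∀ X : Subgroup (HammingAut (ZMod 11) (ZMod 2)),
      ¬ IsCompletelyTransitive X evenHadamardCode) := by
  refine ⟨fun X => ⟨fun h => eq_codeAut_of_isNeighbourTransitive h.1, ?_⟩,
    nonempty_codeAut_mulEquiv, isEntryFaithful_codeAut, not_isNeighbourTransitive_three,
    not_isCompletelyTransitive⟩
  rintro rfl
  exact ⟨isNeighbourTransitive_codeAut, isEntryFaithful_codeAut⟩
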